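/- Let $G$ be a finite group of exponent $m$, let $\omega_m\in\mathbb{C}$ be a primitive $m$-th root of unity, and let $\mathrm{Irr}(G)$ be the set of irreducible complex characters of $G$. For $T_{11},T_{22},T_{12},T_{21}\subseteq G$, let $\Gamma=\mathrm{SC}(G,T_{11},T_{22},T_{12},T_{21})$ be the semi-Cayley digraph: its vertex set is the disjoint union of two copies $G_1=\{g_1\mid g\in G\}$ and $G_2=\{g_2\mid g\in G\}$ of $G$, and $(h_i,g_j)$ is an arc if and only if $gh^{-1}\in T_{ij}$ ($i,j\in\{1,2\}$). Assume that $\Gamma$ is quasi-abelian, i.e. each $T_{ij}$ is a union of conjugacy classes of $G$, and that $T_{11}=T_{22}$ and $T_{12}=T_{12}^{-1}=T_{21}$. Let $\mathrm{SF}(\Gamma)$ be the splitting field of $\Gamma$, i.e. the smallest subfield of $\mathbb{C}$ containing all roots of the characteristic polynomial of the adjacency matrix of $\Gamma$, and let $\deg(\Gamma)=[\mathrm{SF}(\Gamma):\mathbb{Q}]$ be its algebraic degree. For multisets $X,Y$ of elements of $G$ put $\chi(X)=\sum_{x\in X}\chi(x)$, $XY=[xy\mid x\in X,\,y\in Y]$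 and $X^t=[x^t\mid x\in X]$, all with multiplicities. Define $$T=\{t\in\mathbb{Z}_m^*\mid T_{11}^t=T_{11},\ (T_{12}T_{12})^t=T_{12}T_{12}\},\qquad K=\{x\in\mathbb{Q}(\omega_m)\mid \sigma(x)=x\text{ for all }\sigma\in\eta^{-1}(T)\},$$ where $\eta:\mathrm{Gal}(\mathbb{Q}(\omega_m)/\mathbb{Q})\to\mathbb{Z}_m^*$ sends $\sigma$ to the $t$ with $\sigma(\omega_m)=\omega_m^t$. Then $$\mathrm{SF}(\Gamma)=\mathbb{Q}(\chi(T_{11}),\chi(T_{12})\mid\chi\in\mathrm{Irr}(G))=K(\chi(T_{12})\mid\chi\in\mathrm{Irr}(G)),$$ $\chi(T_{12})^2\in K$ for all $\chi\in\mathrm{Irr}(G)$, and $$\deg(\Gamma)=\frac{\varphi(m)\,|M|}{|T|},$$ where $\varphi$ is Euler's function and $M$ is the subgroup of $K^\times/K^{\times2}$ generated by the classes $[\chi(T_{12})^2]_K$ of those $\chi\in\mathrm{Irr}(G)$ with $\chi(T_{12})\neq0$. -/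

import Mathlib

open scoped Pointwise

/-- The adjacency matrix of a digraph, with rational entries `0` and `1`. -/
noncomputable def digraphAdjMatrix {V : Type*} (Γ : Digraph V) : Matrix V V ℚ :=
  open Classical in Matrix.of fun v w => if Γ.Adj v w then 1 else 0

/-- The splitting field of a finite digraph: the smallest subfield of `ℂ` that contains all complex
roots of the characteristic polynomial of the adjacency matrix. -/
noncomputable def digraphSplittingField {V : Type*} [Fintype V] [DecidableEq V] (Γ : Digraph V) :
    IntermediateField ℚ ℂ :=
  IntermediateField.adjoin ℚ ((digraphAdjMatrix Γ).charpoly.rootSet ℂ)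

/-- The algebraic degree of a finite digraph: the degree over `ℚ` of its splitting field. -/
noncomputable def algebraicDegree {V : Type*} [Fintype V] [DecidableEq V] (Γ : Digraph V) : ℕ :=
  Module.finrank ℚ (digraphSplittingField Γ)

/-- The adjacency relation of the semi-Cayley digraph; `Sum.inl g` is `g₁`, `Sum.inr g` is `g₂`. -/
def semiCayleyAdj {G : Type*} [Group G] (T₁₁ T₂₂ T₁₂ T₂₁ : Finset G) : G ⊕ G → G ⊕ G → Prop
  | Sum.inl h, Sum.inl g => g * h⁻¹ ∈ T₁₁
  | Sum.inr h, Sum.inr g => g * h⁻¹ ∈ T₂₂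
  | Sum.inl h, Sum.inr g => g * h⁻¹ ∈ T₁₂
  | Sum.inr h, Sum.inl g => g * h⁻¹ ∈ T₂₁

/-- The semi-Cayley digraph `SC(G, T₁₁, T₂₂, T₁₂, T₂₁)`. -/
def semiCayley {G : Type*} [Group G] (T₁₁ T₂₂ T₁₂ T₂₁ : Finset G) : Digraph (G ⊕ G) where
  Adj := semiCayleyAdj T₁₁ T₂₂ T₁₂ T₂₁

/-- A subset is conjugate-closed (equivalently, a union of conjugacy classes). -/
def IsConjClosed {G : Type*} [Group G] (S : Finset G) : Prop :=
  ∀ s ∈ S, ∀ g : G, g⁻¹ * s * g ∈ S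

/-- `Irr(G)`: the characters of the irreducible complex representations of `G` of finite degree.
(Up to equivalence, a representation of degree `d` acts on `ℂ^d`; the space of an irreducible
representation is nonzero.) -/
def irrChar (G : Type*) [Group G] : Set (G → ℂ) :=
  {χ | ∃ (d : ℕ) (ρ : Representation ℂ G (Fin d → ℂ)), ρ.IsIrreducible ∧ χ = ρ.character}

/-- `χ(X)`, the sum of the values of `χ` over the multiset `X`. -/
noncomputable def charSum {G : Type*} (χ : G → ℂ) (X : Multiset G) : ℂ := (X.map χ).sum

/-- The product `XY` of two multisets in a group, with multiplicities. -/
def multisetMul {G : Type*} [Group G] (X Y : Multiset G) : Multiset G :=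
  (X ×ˢ Y).map fun p => p.1 * p.2

/-- `X ^ t` for a multiset `X` in `G` and a residue `t` modulo the exponent of `G`: the multiset of
the powers `x ^ t`, with multiplicities. -/
noncomputable def multisetPow {G : Type*} [Group G] (X : Multiset G) (t : (ZMod (Monoid.exponent G))ˣ) :
    Multiset G :=
  X.map fun x => x ^ (t : ZMod (Monoid.exponent G)).val

/-- The set `{t ∈ ℤ_m^* ∣ A^t = A, (BB)^t = BB}`, where `m` is the exponent of `G`. -/
def stabUnits {G : Type*} [Group G] (A B : Finset G) : Set (ZMod (Monoid.exponent G))ˣ :=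
  {t | multisetPow A.val t = A.val ∧
    multisetPow (multisetMul B.val B.val) t = multisetMul B.val B.val}

/-- For a primitive `m`-th root of unity `ω`, the map `η : Gal(ℚ(ω)/ℚ) → ℤ_m^*` that sends `σ` to
the `t` with `σ ω = ω ^ t`. -/
noncomputable def cycloEta {m : ℕ} [NeZero m] {ω : ℂ} (hω : IsPrimitiveRoot ω m) :
    (IntermediateField.adjoin ℚ {ω} ≃ₐ[ℚ] IntermediateField.adjoin ℚ {ω}) →* (ZMod m)ˣ :=
  IsPrimitiveRoot.autToPow ℚ
    (μ := (⟨ω, IntermediateField.mem_adjoin_simple_self ℚ ω⟩ : IntermediateField.adjoin ℚ {ω}))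
    (IsPrimitiveRoot.of_map_of_injective (f := (IntermediateField.adjoin ℚ {ω}).val) hω
      (IntermediateField.adjoin ℚ {ω}).val.injective)

theorem cycloEta_spec {m : ℕ} [NeZero m] {ω : ℂ} (hω : IsPrimitiveRoot ω m)
    (σ : IntermediateField.adjoin ℚ {ω} ≃ₐ[ℚ] IntermediateField.adjoin ℚ {ω}) :
    (σ ⟨ω, IntermediateField.mem_adjoin_simple_self ℚ ω⟩ : ℂ) =
      ω ^ ((cycloEta hω σ : (ZMod m)ˣ) : ZMod m).val := by
  have h := IsPrimitiveRoot.autToPow_spec ℚ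
    (μ := (⟨ω, IntermediateField.mem_adjoin_simple_self ℚ ω⟩ : IntermediateField.adjoin ℚ {ω}))
    (IsPrimitiveRoot.of_map_of_injective (f := (IntermediateField.adjoin ℚ {ω}).val) hω
      (IntermediateField.adjoin ℚ {ω}).val.injective) σ
  exact (congrArg Subtype.val h).symm

/-- The field `{x ∈ ℚ(ω) ∣ σ x = x for all σ ∈ η⁻¹(T)}`, as a subfield of `ℚ(ω)`. -/
noncomputable def cycloFixedAux {m : ℕ} [NeZero m] {ω : ℂ} (hω : IsPrimitiveRoot ω m)
    (T : Set (ZMod m)ˣ) : IntermediateField ℚ (IntermediateField.adjoin ℚ {ω}) where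
  carrier := {x | ∀ σ, cycloEta hω σ ∈ T → σ x = x}
  mul_mem' := fun ha hb σ hσ => by rw [map_mul, ha σ hσ, hb σ hσ]
  add_mem' := fun ha hb σ hσ => by rw [map_add, ha σ hσ, hb σ hσ]
  algebraMap_mem' := fun r σ _ => σ.commutes r
  inv_mem' := fun x hx σ hσ => by rw [map_inv₀, hx σ hσ]

/-- The field `{x ∈ ℚ(ω) ∣ σ x = x for all σ ∈ η⁻¹(T)}`, as a subfield of `ℂ`. -/
noncomputable def cycloFixed {m : ℕ} [NeZero m] {ω : ℂ} (hω : IsPrimitiveRoot ω m)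
    (T : Set (ZMod m)ˣ) : IntermediateField ℚ ℂ :=
  IntermediateField.lift (cycloFixedAux hω T)

/-- The subgroup of `K^× / K^{×2}` generated by the square classes `[a]_K` of the nonzero elements
`a` of `K` that lie in `S`. -/
noncomputable def squareClassGroup (K : IntermediateField ℚ ℂ) (S : Set ℂ) :
    Subgroup ((K : Type)ˣ ⧸ (powMonoidHom 2 : (K : Type)ˣ →* (K : Type)ˣ).range) :=
  Subgroup.closure {c | ∃ a : (K : Type)ˣ, ((a : K) : ℂ) ∈ S ∧ c = QuotientGroup.mk a}

instance neZero_exponent_of_finite {G : Type*} [Group G] [Finite G] :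
    NeZero (Monoid.exponent G) :=
  ⟨Monoid.exponent_ne_zero_of_finite⟩

/-! Write `A` for `T₁₁ = T₂₂` and `B` for `T₁₂ = T₂₁`. The adjacency matrix has equal diagonal
blocks and equal off-diagonal blocks, so it decouples on vectors `(φ, φ)` and `(φ, -φ)` into
convolutions by the class functions `1_A ± 1_B`. By Schur's lemma the eigenvalues are `(χ(A) ± χ(B))
/ χ(1)` (`mem_rootSet_charpoly_semiCayley_iff`). As `χ(1)` is a positive integer, they generate the
same field as all `χ(A)` and `χ(B)`.

An automorphism `σ` of `ℚ(ω)` with `η(σ) = t` sends `χ(X)` to `χ(X^t)`, because character values are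
sums of roots of unity. Irreducible characters separate conjugation-invariant multisets
(`eq_of_forall_charSum_eq`), and `χ(BB) χ(1) = χ(B)²`. Hence `t ∈ T` exactly when `σ` fixes every
`χ(A)` and every `χ(B)²` (`mem_stabUnits_iff_forall_fixed`). Galois theory then says that these
numbers generate `K` and that `[K : ℚ] = φ(m) / |T|`.

Finally, the splitting field is `K(χ(B))`, generated by square roots of elements of `K`. Kummer
theory of exponent two (`finrank_adjoin_of_sq_mem`) gives its degree over `K` as `|M|`, and the
tower law finishes. -/

/-! ### Kummer theory of exponent two -/

/-- A field of characteristic zero generated by square roots is Galois. -/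
theorem isGalois_adjoin_of_sq_mem {K L : Type*} [Field K] [CharZero K] [Field L] [Algebra K L]
    {S : Set L} (hS : ∀ s ∈ S, ∃ k : K, s ^ 2 = algebraMap K L k) :
    IsGalois K (IntermediateField.adjoin K S) := by
  open Polynomial in
  -- Each generator gives the splitting field of `X ^ 2 - k`; a compositum of normal extensions is
  -- normal.
  have hnormal : ∀ s : S, Normal K (IntermediateField.adjoin K {(s : L)}) := by
    intro s
    obtain ⟨k, hk⟩ := hS s s.2
    have hsp : ((X ^ 2 - C k : K[X]).map (algebraMap K L)) =
        (X - C (s : L)) * (X - C (-(s : L))) := by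
      have : C (algebraMap K L k) = C (s : L) ^ 2 := by rw [← hk, map_pow]
      simp only [Polynomial.map_sub, Polynomial.map_pow, map_X, map_C, this, C_neg]
      ring
    have hsplits : ((X ^ 2 - C k : K[X]).map (algebraMap K L)).Splits := by
      rw [hsp]
      exact (Splits.X_sub_C _).mul (Splits.X_sub_C _)
    have hroot : IntermediateField.adjoin K ((X ^ 2 - C k : K[X]).rootSet L) =
        IntermediateField.adjoin K {(s : L)} := by
      have hset : (X ^ 2 - C k : K[X]).rootSet L = {(s : L), -(s : L)} := by
        ext z
        have hne : (X ^ 2 - C k : K[X]) ≠ 0 := X_pow_sub_C_ne_zero (by norm_num) k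
        rw [mem_rootSet_of_ne hne]
        simp only [map_sub, map_pow, aeval_X, aeval_C, ← hk, Set.mem_insert_iff,
          Set.mem_singleton_iff, sub_eq_zero, sq_eq_sq_iff_eq_or_eq_neg]
      rw [hset]
      apply le_antisymm
      · rw [IntermediateField.adjoin_le_iff]
        rintro z (rfl | rfl)
        · exact IntermediateField.mem_adjoin_simple_self K _
        · exact neg_mem (IntermediateField.mem_adjoin_simple_self K _)
      · exact IntermediateField.adjoin.mono _ _ _ (by simp)
    have := IntermediateField.adjoin_rootSet_isSplittingField hsplits
    rw [← hroot]
    exact Normal.of_isSplittingField (X ^ 2 - C k)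
  have hN : Normal K (IntermediateField.adjoin K S) := by
    have : IntermediateField.adjoin K S = ⨆ s : S, IntermediateField.adjoin K {(s : L)} := by
      rw [← IntermediateField.adjoin_iUnion]
      congr 1
      ext z
      simp
    rw [this]
    exact IntermediateField.normal_iSup (h := hnormal)
  exact { to_normal := hN, to_isSeparable := inferInstance }

/-- If `b = a u²`, then `u x` and `y` have the same square and so agree up to sign. Thus a square
class determines its square root up to a factor from `K`. -/
theorem exists_eq_algebraMap_mul_of_squareClass_eq {K L : Type*} [Field K] [Field L] [Algebra K L]
    {a b : Kˣ} {x y : L} (hx : x ^ 2 = algebraMap K L a) (hy : y ^ 2 = algebraMap K L b)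
    (hab : (QuotientGroup.mk a : Kˣ ⧸ (powMonoidHom 2 : Kˣ →* Kˣ).range) = QuotientGroup.mk b) :
    ∃ k : K, x = algebraMap K L k * y := by
  rw [QuotientGroup.eq] at hab
  obtain ⟨u, hu⟩ := hab
  have hu' : b = a * u ^ 2 := by
    rw [← powMonoidHom_apply 2 u, hu, mul_inv_cancel_left]
  have hsq : (algebraMap K L u * x) ^ 2 = y ^ 2 := by
    rw [mul_pow, hx, hy, hu']
    simp [mul_comm]
  have hu0 : algebraMap K L (u : K) ≠ 0 := by simp
  rcases sq_eq_sq_iff_eq_or_eq_neg.1 hsq with h | h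
  · exact ⟨(u : K)⁻¹, by rw [← h, map_inv₀, inv_mul_cancel_left₀ hu0]⟩
  · refine ⟨-(u : K)⁻¹, ?_⟩
    rw [map_neg, map_inv₀, neg_mul, ← mul_neg, ← h, inv_mul_cancel_left₀ hu0]

/-- Square roots of elements in distinct square classes are linearly independent. -/
theorem linearIndependent_of_squareClass_injective {K F ι : Type*} [Field K] [CharZero K] [Field F]
    [Algebra K F] [IsGalois K F] (d : ι → F) (a : ι → Kˣ)
    (hd : ∀ i, d i ^ 2 = algebraMap K F (a i))
    (ha : Function.Injective fun i =>
      (QuotientGroup.mk (a i) : Kˣ ⧸ (powMonoidHom 2 : Kˣ →* Kˣ).range)) :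
    LinearIndependent K d := by
  have hd0 : ∀ i, d i ≠ 0 := fun i h => by
    have := hd i
    rw [h, zero_pow two_ne_zero, eq_comm] at this
    simp at this
  have hsign : ∀ (σ : F ≃ₐ[K] F) i, σ (d i) = d i ∨ σ (d i) = -d i := fun σ i => by
    rw [← sq_eq_sq_iff_eq_or_eq_neg, ← map_pow, hd, AlgEquiv.commutes]
  -- The Kummer character of `d i`: its values are signs, which `σ` fixes, whence multiplicativity.
  let χ : ι → (F ≃ₐ[K] F) →* F := fun i =>
    { toFun := fun σ => σ (d i) / d i
      map_one' := by simp [hd0 i]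
      map_mul' := fun σ τ => by
        have := hd0 i
        rw [AlgEquiv.mul_apply]
        rcases hsign σ i with h | h <;> rcases hsign τ i with h' | h' <;>
          simp [h, h', this] }
  -- If two sign characters agree, `d i * d j` is Galois-invariant, hence in `K`; then `a i * a j`
  -- is a square in `K` and the classes coincide.
  have hχ : Function.Injective χ := by
    intro i j hij
    apply ha
    have hfix : ∀ σ : F ≃ₐ[K] F, σ (d i * d j) = d i * d j := by
      intro σ
      have h : σ (d i) / d i = σ (d j) / d j := DFunLike.congr_fun hij σ
      have h0 := hd0 i
      have h0' := hd0 j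
      have h2 : d j ^ 2 = σ (d j) ^ 2 := by rw [← map_pow, hd, AlgEquiv.commutes]
      rw [div_eq_div_iff h0 h0'] at h
      rw [map_mul]
      apply mul_right_cancel₀ h0'
      calc σ (d i) * σ (d j) * d j = (σ (d i) * d j) * σ (d j) := by ring
        _ = d i * σ (d j) ^ 2 := by rw [h]; ring
        _ = d i * d j * d j := by rw [← h2]; ring
    obtain ⟨k, hk⟩ := (InfiniteGalois.mem_range_algebraMap_iff_fixed (k := K) (d i * d j)).2 hfix
    have hk0 : k ≠ 0 := by
      rintro rfl
      rw [map_zero, eq_comm] at hk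
      exact mul_ne_zero (hd0 i) (hd0 j) hk
    have hk2 : k ^ 2 = a i * a j := by
      apply (algebraMap K F).injective
      rw [map_pow, hk, mul_pow, hd, hd, map_mul]
    change (QuotientGroup.mk (a i) : Kˣ ⧸ (powMonoidHom 2 : Kˣ →* Kˣ).range) = QuotientGroup.mk _
    rw [QuotientGroup.eq]
    refine ⟨(a i)⁻¹ * Units.mk0 k hk0, ?_⟩
    ext
    simp only [powMonoidHom_apply, Units.val_pow_eq_pow_val, Units.val_mul, Units.val_mk0, mul_pow,
      hk2]
    have := (a i).ne_zero
    simp only [Units.val_inv_eq_inv_val]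
    field_simp
  -- Dedekind's independence of characters: applying every `σ` to a relation `∑ g j • d j = 0` gives
  -- a relation between the characters with coefficients `g j * d j`.
  have hli := (linearIndependent_monoidHom (F ≃ₐ[K] F) F).comp χ hχ
  rw [linearIndependent_iff'] at hli ⊢
  intro s g hg i hi
  have := hli s (fun i => algebraMap K F (g i) * d i) (by
    ext σ
    have h := congrArg σ hg
    simp only [Algebra.smul_def, map_sum, map_mul, AlgEquiv.commutes, map_zero] at h
    simp only [Function.comp_apply, Finset.sum_apply, Pi.smul_apply, smul_eq_mul, Pi.zero_apply]
    rw [← h]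
    refine Finset.sum_congr rfl fun j _ => ?_
    change algebraMap K F (g j) * d j * (σ (d j) / d j) = _
    have := hd0 j
    field_simp) i hi
  simpa [hd0 i] using this

/-- Kummer theory for exponent two: the degree of an extension generated by square roots is the
order of the group of square classes that they generate. -/
theorem finrank_adjoin_of_sq_mem {K L : Type*} [Field K] [CharZero K] [Field L] [Algebra K L]
    {S : Set L} (hS : ∀ s ∈ S, ∃ k : K, s ^ 2 = algebraMap K L k) :
    Module.finrank K (IntermediateField.adjoin K S) =
      Nat.card (Subgroup.closure {c : Kˣ ⧸ (powMonoidHom 2 : Kˣ →* Kˣ).range |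
        ∃ a : Kˣ, (∃ s ∈ S, algebraMap K L a = s ^ 2) ∧ c = QuotientGroup.mk a}) := by
  set F := IntermediateField.adjoin K S with hF
  set N := Subgroup.closure {c : Kˣ ⧸ (powMonoidHom 2 : Kˣ →* Kˣ).range |
        ∃ a : Kˣ, (∃ s ∈ S, algebraMap K L a = s ^ 2) ∧ c = QuotientGroup.mk a} with hN
  have : IsGalois K F := isGalois_adjoin_of_sq_mem hS
  -- One square root in `F` is chosen for each class in `N`; these roots will form a `K`-basis of
  -- `F`.
  have hex : ∀ c : N, ∃ (a : Kˣ) (d : F), d ^ 2 = algebraMap K F a ∧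
      QuotientGroup.mk a = (c : Kˣ ⧸ (powMonoidHom 2 : Kˣ →* Kˣ).range) := by
    rintro ⟨c, hc⟩
    induction hc using Subgroup.closure_induction with
    | mem x hx =>
      obtain ⟨a, ⟨s, hs, has⟩, rfl⟩ := hx
      exact ⟨a, ⟨s, IntermediateField.subset_adjoin K S hs⟩, Subtype.ext has.symm, rfl⟩
    | one => exact ⟨1, 1, by simp, rfl⟩
    | mul x y hx hy ihx ihy =>
      obtain ⟨a, d, h, h'⟩ := ihx
      obtain ⟨b, e, k, k'⟩ := ihy
      refine ⟨a * b, d * e, by rw [mul_pow, h, k, Units.val_mul, map_mul], ?_⟩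
      simp only at h' k' ⊢
      rw [← h', ← k']
      rfl
    | inv x hx ihx =>
      obtain ⟨a, d, h, h'⟩ := ihx
      refine ⟨a⁻¹, d⁻¹, by rw [inv_pow, h, Units.val_inv_eq_inv_val, map_inv₀], ?_⟩
      simp only at h' ⊢
      rw [← h']
      rfl
  choose a d hd ha using hex
  have hli : LinearIndependent K d := by
    refine linearIndependent_of_squareClass_injective d a hd fun i j hij => ?_
    simp only [ha] at hij
    exact Subtype.ext hij
  have hmem : ∀ m ∈ Submonoid.closure S, m = 0 ∨ ∃ b : Kˣ, m ^ 2 = algebraMap K L b ∧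
      (QuotientGroup.mk b : Kˣ ⧸ (powMonoidHom 2 : Kˣ →* Kˣ).range) ∈ N := by
    intro m hm
    induction hm using Submonoid.closure_induction with
    | mem x hx =>
      by_cases hx0 : x = 0
      · exact Or.inl hx0
      obtain ⟨k, hk⟩ := hS x hx
      have hk0 : k ≠ 0 := by
        rintro rfl
        exact hx0 (by simpa using hk)
      exact Or.inr ⟨Units.mk0 k hk0, hk, Subgroup.subset_closure ⟨_, ⟨x, hx, hk.symm⟩, rfl⟩⟩
    | one => exact Or.inr ⟨1, by simp, one_mem N⟩
    | mul x y _ _ ihx ihy =>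
      rcases ihx with rfl | ⟨b, hb, hbN⟩
      · simp
      rcases ihy with rfl | ⟨c, hc, hcN⟩
      · simp
      exact Or.inr ⟨b * c, by rw [mul_pow, hb, hc, Units.val_mul, map_mul], mul_mem hbN hcN⟩
  -- The generators are algebraic, so `F` is spanned by their products; each nonzero product is a
  -- `K`-multiple of the chosen root of its class.
  have hspan : ⊤ ≤ Submodule.span K (Set.range d) := by
    rintro ⟨x, hx⟩ -
    have halg : ∀ s ∈ S, IsAlgebraic K s := fun s hs => by
      obtain ⟨k, hk⟩ := hS s hs
      exact (IsAlgebraic.of_pow two_pos (hk ▸ isAlgebraic_algebraMap k))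
    have hx' : x ∈ Submodule.span K (Submonoid.closure S : Set L) := by
      rw [← Algebra.adjoin_eq_span, Subalgebra.mem_toSubmodule,
        ← IntermediateField.adjoin_toSubalgebra_of_isAlgebraic halg]
      exact hx
    have hle : Submodule.span K (Submonoid.closure S : Set L) ≤
        (Submodule.span K (Set.range d)).map F.val.toLinearMap := by
      rw [Submodule.span_le]
      intro m hm
      rcases hmem m hm with rfl | ⟨b, hb, hbN⟩
      · exact zero_mem _
      obtain ⟨k, hk⟩ := exists_eq_algebraMap_mul_of_squareClass_eq (L := L) (y := (d ⟨_, hbN⟩ : L))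
        hb (congrArg Subtype.val (hd ⟨_, hbN⟩)) (ha ⟨_, hbN⟩).symm
      refine ⟨k • d ⟨_, hbN⟩, Submodule.smul_mem _ _ (Submodule.subset_span ⟨_, rfl⟩), ?_⟩
      rw [hk, ← Algebra.smul_def]
      rfl
    obtain ⟨y, hy, hyx⟩ := hle hx'
    have : y = ⟨x, hx⟩ := Subtype.ext hyx
    exact this ▸ hy
  exact Module.finrank_eq_nat_card_basis (Module.Basis.mk hli hspan)

/-! ### Eigenvectors and irreducible subrepresentations -/

/-- The complex roots of the characteristic polynomial of a complex matrix are its eigenvalues. -/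
theorem isRoot_charpoly_iff_exists_mulVec {n : Type*} [Fintype n] [DecidableEq n]
    (M : Matrix n n ℂ) (μ : ℂ) :
    M.charpoly.IsRoot μ ↔ ∃ v : n → ℂ, v ≠ 0 ∧ M.mulVec v = μ • v := by
  rw [← Matrix.charpoly_toLin', ← Module.End.hasEigenvalue_iff_isRoot_charpoly]
  constructor
  · intro h
    obtain ⟨v, hv⟩ := h.exists_hasEigenvector
    exact ⟨v, hv.2, by simpa using hv.apply_eq_smul⟩
  · rintro ⟨v, hv, h⟩
    exact Module.End.hasEigenvalue_of_hasEigenvector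
      (x := v) ⟨Module.End.mem_eigenspace_iff.2 (by simpa using h), hv⟩

/-- Every nonzero subrepresentation of a finite-dimensional representation contains an irreducible
one, in coordinates. -/
theorem exists_isIrreducible_le {G V : Type*} [Group G] [AddCommGroup V] [Module ℂ V]
    [FiniteDimensional ℂ V] {ρ : Representation ℂ G V} (W : Subrepresentation ρ) (hW : W ≠ ⊥) :
    ∃ (d : ℕ) (σ : Representation ℂ G (Fin d → ℂ)) (f : (Fin d → ℂ) →ₗ[ℂ] V),
      σ.IsIrreducible ∧ Function.Injective f ∧ (∀ g x, f (σ g x) = ρ g (f x)) ∧ ∀ x, f x ∈ W := by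
  have hmono : StrictMono (Subrepresentation.toSubmodule : Subrepresentation ρ → Submodule ℂ V) :=
    fun A B hAB => lt_of_le_of_ne hAB.le fun h =>
      hAB.ne (Subrepresentation.toSubmodule_injective h)
  have : WellFoundedLT (Subrepresentation ρ) := hmono.wellFoundedLT
  have : IsAtomic (Subrepresentation ρ) := isAtomic_of_orderBot_wellFounded_lt wellFounded_lt
  -- An atom in the lattice of subrepresentations is irreducible; a basis transports it to `Fin d →
  -- ℂ`.
  obtain ⟨U, hU, hUW⟩ := (IsAtomic.eq_bot_or_exists_atom_le W).resolve_left hW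
  let e : U.toSubmodule ≃ₗ[ℂ] (Fin (Module.finrank ℂ U.toSubmodule) → ℂ) :=
    (Module.finBasis ℂ U.toSubmodule).equivFun
  let σ : Representation ℂ G (Fin (Module.finrank ℂ U.toSubmodule) → ℂ) :=
    { toFun := fun g => e.conj (U.toRepresentation g)
      map_one' := by rw [map_one]; ext; simp [LinearEquiv.conj_apply]
      map_mul' := fun g h => by rw [map_mul, Module.End.mul_eq_comp, LinearEquiv.conj_comp]; rfl }
  let f : (Fin (Module.finrank ℂ U.toSubmodule) → ℂ) →ₗ[ℂ] V :=
    U.toSubmodule.subtype ∘ₗ e.symm.toLinearMap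
  have hf : Function.Injective f :=
    Subtype.val_injective.comp e.symm.injective
  have hfσ : ∀ g x, f (σ g x) = ρ g (f x) := fun g x => by
    change ((e.symm (e (U.toRepresentation g (e.symm x))) : U.toSubmodule) : V) = _
    rw [LinearEquiv.symm_apply_apply]
    rfl
  have hfU : ∀ x, f x ∈ U := fun x => (e.symm x).2
  refine ⟨_, σ, f, ?_, hf, hfσ, fun x => hUW (hfU x)⟩
  have hnt : Nontrivial (Subrepresentation σ) := by
    refine ⟨⊥, ⊤, fun h => hU.1 ?_⟩
    apply Subrepresentation.toSubmodule_injective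
    change U.toSubmodule = ⊥
    rw [eq_bot_iff]
    intro v hv
    have h1 : e ⟨v, hv⟩ ∈ (⊥ : Subrepresentation σ) := by
      rw [h]
      exact Submodule.mem_top
    have h2 : e ⟨v, hv⟩ = 0 := h1
    rw [LinearEquiv.map_eq_zero_iff] at h2
    exact congrArg Subtype.val h2
  refine { toNontrivial := hnt, eq_bot_or_eq_top := fun P => ?_ }
  let P' : Subrepresentation ρ :=
    { toSubmodule := P.toSubmodule.map f
      apply_mem_toSubmodule := by
        rintro g _ ⟨x, hx, rfl⟩
        exact ⟨σ g x, P.apply_mem_toSubmodule g hx, hfσ g x⟩ }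
  have hP' : P' ≤ U := by
    rintro _ ⟨x, -, rfl⟩
    exact hfU x
  rcases hU.le_iff.1 hP' with h | h
  · left
    apply Subrepresentation.toSubmodule_injective
    change P.toSubmodule = ⊥
    rw [eq_bot_iff]
    intro x hx
    have h1 : f x ∈ P' := ⟨x, hx, rfl⟩
    rw [h] at h1
    have h2 : f x = 0 := h1
    exact hf (h2.trans (map_zero f).symm)
  · right
    apply Subrepresentation.toSubmodule_injective
    change P.toSubmodule = ⊤
    rw [eq_top_iff]
    intro x _
    have h1 : f x ∈ P' := by
      rw [h]
      exact hfU x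
    obtain ⟨y, hy, hyx⟩ := h1
    rw [← hf hyx]
    exact hy

/-! ### Class functions, central characters and convolution -/

section CentralElements

variable {G : Type*} [Group G]

theorem irrChar_one_ne_zero {χ : G → ℂ} (hχ : χ ∈ irrChar G) : χ 1 ≠ 0 := by
  obtain ⟨d, ρ, hρ, rfl⟩ := hχ
  rw [Representation.char_one]
  intro h
  have hd : d = 0 := by simpa using h
  subst hd
  obtain ⟨A, B, hAB⟩ := hρ.toNontrivial
  exact hAB (Subrepresentation.toSubmodule_injective (Subsingleton.elim _ _))

theorem irrChar_one_eq_natCast {χ : G → ℂ} (hχ : χ ∈ irrChar G) : ∃ d : ℕ, χ 1 = d := by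
  obtain ⟨d, ρ, hρ, rfl⟩ := hχ
  exact ⟨d, by rw [Representation.char_one]; simp⟩

theorem irrChar_mul_comm {χ : G → ℂ} (hχ : χ ∈ irrChar G) (g h : G) : χ (g * h) = χ (h * g) := by
  obtain ⟨d, ρ, hρ, rfl⟩ := hχ
  exact ρ.char_mul_comm h g

variable [Fintype G]

/-- Schur's lemma: a class function acts by a scalar on an irreducible representation. -/
theorem exists_smul_eq_sum_of_isIrreducible {V : Type*} [AddCommGroup V] [Module ℂ V]
    [FiniteDimensional ℂ V] (ρ : Representation ℂ G V) [hρ : ρ.IsIrreducible] (w : G → ℂ)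
    (hw : ∀ k g, w (k * g * k⁻¹) = w g) : ∃ c : ℂ, ∑ g, w g • ρ g = c • LinearMap.id := by
  have hcomm : ∀ k v, (∑ g, w g • ρ g) (ρ k v) = ρ k ((∑ g, w g • ρ g) v) := by
    intro k v
    simp only [LinearMap.sum_apply, LinearMap.smul_apply, map_sum, map_smul]
    refine Fintype.sum_equiv (MulAut.conj k⁻¹).toEquiv _ _ fun g => ?_
    simp only [MulEquiv.toEquiv_eq_coe, MulEquiv.coe_toEquiv, MulAut.conj_apply, inv_inv]
    have := hw k⁻¹ g
    rw [inv_inv] at this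
    rw [this, ← Module.End.mul_apply, ← Module.End.mul_apply, ← map_mul, ← map_mul]
    congr 3
    group
  obtain ⟨c, hc⟩ :=
    (Representation.IsIrreducible.algebraMap_intertwiningMap_bijective_of_isAlgClosed
      (ρ := ρ)).2 (LinearMap.intertwiningMap_of_isIntertwiningMap ρ ρ _ hcomm)
  refine ⟨c, LinearMap.ext fun v => ?_⟩
  have := congrArg (fun f : Representation.IntertwiningMap ρ ρ => f v) hc
  exact this.symm

/-- A central element acts on the values of an irreducible character by multiplication. -/
theorem irrChar_sum_mul {χ : G → ℂ} (hχ : χ ∈ irrChar G) (w : G → ℂ)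
    (hw : ∀ k g, w (k * g * k⁻¹) = w g) (k : G) :
    (∑ g, w g * χ (k * g)) * χ 1 = (∑ g, w g * χ g) * χ k := by
  obtain ⟨d, ρ, hρ, rfl⟩ := hχ
  obtain ⟨c, hc⟩ := exists_smul_eq_sum_of_isIrreducible ρ w hw
  -- Multiply the scalar identity by `ρ k` and take traces; `k = 1` then identifies `c`.
  have key : ∀ k, ∑ g, w g * ρ.character (k * g) = c * ρ.character k := by
    intro k
    have := congrArg (fun A => LinearMap.trace ℂ (Fin d → ℂ) (ρ k * A)) hc
    simpa [Finset.mul_sum, ← map_mul, Representation.character, ← Module.End.one_eq_id] using this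
  have h1 := key 1
  simp only [one_mul] at h1
  rw [key, h1]
  ring

/-- The central character of an irreducible character is an eigenvalue of the convolution by a class
function. -/
theorem exists_eigenfunction_of_irrChar {χ : G → ℂ} (hχ : χ ∈ irrChar G) (w : G → ℂ)
    (hw : ∀ k g, w (k * g * k⁻¹) = w g) :
    ∃ φ : G → ℂ, φ ≠ 0 ∧ ∀ h, ∑ g, w g * φ (g * h) = ((∑ g, w g * χ g) / χ 1) * φ h := by
  refine ⟨χ, fun h => irrChar_one_ne_zero hχ (congrFun h 1), fun h => ?_⟩
  have h1 := irrChar_one_ne_zero hχ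
  rw [div_mul_eq_mul_div, eq_div_iff h1, ← irrChar_sum_mul hχ w hw h]
  simp only [irrChar_mul_comm hχ h]

/-- The eigenvalues of the convolution by a class function are values of central characters. -/
theorem exists_irrChar_of_eigenfunction (w : G → ℂ)
    (hw : ∀ k g, w (k * g * k⁻¹) = w g) {μ : ℂ} {φ : G → ℂ} (hφ : φ ≠ 0)
    (h : ∀ h, ∑ g, w g * φ (g * h) = μ * φ h) :
    ∃ χ ∈ irrChar G, ∑ g, w g * χ g = μ * χ 1 := by
  -- Right translation commutes with the convolution, which uses left multiplication; the eigenspace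
  -- `W` is therefore a subrepresentation.
  let ρ : Representation ℂ G (G → ℂ) :=
    { toFun := fun k => LinearMap.funLeft ℂ ℂ (fun g => g * k)
      map_one' := by ext; simp [LinearMap.funLeft]
      map_mul' := fun a b => by ext; simp [LinearMap.funLeft, mul_assoc] }
  have hρ : ∀ k ψ h, ρ k ψ h = ψ (h * k) := fun k ψ h => rfl
  let W : Subrepresentation ρ :=
    { toSubmodule :=
        { carrier := {ψ | ∀ h, ∑ g, w g * ψ (g * h) = μ * ψ h}
          zero_mem' := by intro h; simp
          add_mem' := by
            intro a b ha hb h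
            simp only [Pi.add_apply, mul_add, Finset.sum_add_distrib, ha h, hb h]
          smul_mem' := by
            intro c a ha h
            simp only [Pi.smul_apply, smul_eq_mul, mul_left_comm _ c, ← Finset.mul_sum, ha h] }
      apply_mem_toSubmodule := by
        intro k ψ hψ h
        simp only [hρ, mul_assoc]
        exact hψ (h * k) }
  have hW : W ≠ ⊥ := by
    intro hbot
    have h1 : φ ∈ W := h
    rw [hbot] at h1
    exact hφ h1
  obtain ⟨d, σ, f, hσ, hf, hfσ, hfW⟩ := exists_isIrreducible_le W hW
  refine ⟨σ.character, ⟨d, σ, hσ, rfl⟩, ?_⟩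
  -- Since `w` is a class function, replacing `g` by `h * g * h⁻¹` turns the right action of `∑ w g
  -- • ρ g` into the convolution, which is `μ` on `W`.
  have hact : ∑ g, w g • σ g = μ • LinearMap.id := by
    refine LinearMap.ext fun x => hf ?_
    have hx : ∀ h, ∑ g, w g * f x (g * h) = μ * f x h := hfW x
    simp only [LinearMap.sum_apply, LinearMap.smul_apply, map_sum, map_smul, hfσ, LinearMap.id_apply]
    ext h
    simp only [Finset.sum_apply, Pi.smul_apply, smul_eq_mul, hρ]
    rw [← hx h]
    refine Fintype.sum_equiv (MulAut.conj h).toEquiv _ _ fun g => ?_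
    simp [hw]
  have := congrArg (LinearMap.trace ℂ (Fin d → ℂ)) hact
  simpa [Representation.character, ← Module.End.one_eq_id] using this

/-- A class function orthogonal to all irreducible characters vanishes. -/
theorem eq_zero_of_forall_irrChar_sum_eq_zero [DecidableEq G] (w : G → ℂ)
    (hw : ∀ k g, w (k * g * k⁻¹) = w g)
    (h : ∀ χ ∈ irrChar G, ∑ g, w g * χ g = 0) : w = 0 := by
  -- The autocorrelation of `w` is again a class function orthogonal to `irrChar G`, and `u 1 = ∑ |w
  -- x|²`. Its convolution matrix has only zero eigenvalues, so its trace `|G| * u 1` vanishes.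
  set u : G → ℂ := fun g => ∑ x, w (g * x) * starRingEnd ℂ (w x) with hu
  have huc : ∀ k g, u (k * g * k⁻¹) = u g := by
    intro k g
    refine Fintype.sum_equiv (MulAut.conj k⁻¹).toEquiv _ _ fun x => ?_
    simp only [MulEquiv.toEquiv_eq_coe, MulEquiv.coe_toEquiv, MulAut.conj_apply]
    rw [hw, ← hw k (g * (k⁻¹ * x * k⁻¹⁻¹))]
    congr 2
    group
  have huχ : ∀ χ ∈ irrChar G, ∑ g, u g * χ g = 0 := by
    intro χ hχ
    have h1 : ∀ x, ∑ g, w (g * x) * χ g = 0 := by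
      intro x
      have h2 := irrChar_sum_mul hχ w hw x⁻¹
      rw [h χ hχ, zero_mul, mul_eq_zero, or_iff_left (irrChar_one_ne_zero hχ)] at h2
      rw [← h2]
      refine Fintype.sum_equiv (Equiv.mulRight x) _ _ fun g => ?_
      simp [irrChar_mul_comm hχ x⁻¹]
    simp only [hu, Finset.sum_mul]
    rw [Finset.sum_comm]
    refine Finset.sum_eq_zero fun x _ => ?_
    rw [← mul_zero (starRingEnd ℂ (w x)), ← h1 x, Finset.mul_sum]
    exact Finset.sum_congr rfl fun g _ => by ring
  set M : Matrix G G ℂ := Matrix.of fun a b => u (b * a⁻¹) with hM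
  have hroots : ∀ μ ∈ M.charpoly.roots, μ = 0 := by
    intro μ hμ
    rw [Polynomial.mem_roots M.charpoly_monic.ne_zero, isRoot_charpoly_iff_exists_mulVec] at hμ
    obtain ⟨φ, hφ, hφμ⟩ := hμ
    obtain ⟨χ, hχ, h1⟩ := exists_irrChar_of_eigenfunction u huc hφ (μ := μ) (by
      intro a
      have h1 := congrFun hφμ a
      rw [Pi.smul_apply, smul_eq_mul] at h1
      rw [← h1]
      refine Fintype.sum_equiv (Equiv.mulRight a) _ _ fun g => ?_
      simp [hM])
    rw [huχ χ hχ, eq_comm, mul_eq_zero, or_iff_left (irrChar_one_ne_zero hχ)] at h1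
    exact h1
  have htr : M.trace = 0 := by
    rw [Matrix.trace_eq_sum_roots_charpoly]
    exact Multiset.sum_eq_zero hroots
  have hu1 : u 1 = 0 := by simpa [Matrix.trace, hM] using htr
  have hsum : ∑ x, Complex.normSq (w x) = 0 := by
    have : ((∑ x, Complex.normSq (w x) : ℝ) : ℂ) = 0 := by
      rw [← hu1]
      simp [hu, Complex.mul_conj]
    exact_mod_cast this
  rw [Finset.sum_eq_zero_iff_of_nonneg fun x _ => Complex.normSq_nonneg _] at hsum
  ext x
  exact Complex.normSq_eq_zero.1 (hsum x (Finset.mem_univ x))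

end CentralElements

/-! ### Galois action on character values and the cyclotomic fixed field -/

/-- The powers of an endomorphism of finite order are simultaneously diagonalizable, so that their
traces are power sums of roots of unity. -/
theorem exists_trace_pow_eq_sum {V : Type*} [AddCommGroup V] [Module ℂ V] [FiniteDimensional ℂ V]
    {m : ℕ} (hm : m ≠ 0) (f : Module.End ℂ V) (hf : f ^ m = 1) :
    ∃ (s : Finset ℂ) (n : ℂ → ℕ), (∀ μ ∈ s, μ ^ m = 1) ∧
      ∀ t : ℕ, LinearMap.trace ℂ V (f ^ t) = ∑ μ ∈ s, (n μ : ℂ) * μ ^ t := by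
  have hss : f.IsSemisimple := by
    refine Module.End.isSemisimple_of_squarefree_aeval_eq_zero (p := Polynomial.X ^ m - 1) ?_ ?_
    · exact (Polynomial.X_pow_sub_one_separable_iff.2 (by exact_mod_cast hm)).squarefree
    · simp [hf]
  have hfin : {μ | f.eigenspace μ ≠ ⊥}.Finite :=
    WellFoundedGT.finite_ne_bot_of_iSupIndep f.eigenspaces_iSupIndep
  have hint : DirectSum.IsInternal f.eigenspace :=
    DirectSum.isInternal_submodule_of_iSupIndep_of_iSup_eq_top f.eigenspaces_iSupIndep
      hss.iSup_eigenspace_eq_top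
  have hpow : ∀ (μ : ℂ) (t : ℕ) (v : V), v ∈ f.eigenspace μ → (f ^ t) v = μ ^ t • v := by
    intro μ t v hv
    rw [Module.End.mem_eigenspace_iff] at hv
    induction t with
    | zero => simp
    | succ t ih => rw [pow_succ', Module.End.mul_apply, ih, map_smul, hv, smul_smul, ← pow_succ]
  refine ⟨hfin.toFinset, fun μ => Module.finrank ℂ (f.eigenspace μ), fun μ hμ => ?_, fun t => ?_⟩
  · rw [Set.Finite.mem_toFinset] at hμ
    obtain ⟨v, hv, hv0⟩ := Submodule.exists_mem_ne_zero_of_ne_bot hμ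
    have h := hpow μ m v hv
    rw [hf, Module.End.one_apply] at h
    have h' : (μ ^ m - 1) • v = 0 := by rw [sub_smul, one_smul, ← h, sub_self]
    exact sub_eq_zero.1 ((smul_eq_zero.1 h').resolve_right hv0)
  · have hmaps : ∀ μ, Set.MapsTo (f ^ t) (f.eigenspace μ) (f.eigenspace μ) := by
      intro μ v hv
      change (f ^ t) v ∈ f.eigenspace μ
      rw [hpow μ t v hv]
      exact Submodule.smul_mem _ _ hv
    rw [LinearMap.trace_eq_sum_trace_restrict' hint hfin hmaps]
    refine Finset.sum_congr rfl fun μ _ => ?_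
    have : (f ^ t).restrict (hmaps μ) = (μ ^ t) • LinearMap.id := by
      ext v
      exact hpow μ t v v.2
    rw [this, map_smul, ← Module.End.one_eq_id, LinearMap.trace_one, smul_eq_mul, mul_comm]

theorem exists_irrChar_pow_eq_sum {G : Type*} [Group G] [Finite G] {χ : G → ℂ}
    (hχ : χ ∈ irrChar G) (x : G) :
    ∃ (s : Finset ℂ) (n : ℂ → ℕ), (∀ μ ∈ s, μ ^ Monoid.exponent G = 1) ∧
      ∀ t : ℕ, χ (x ^ t) = ∑ μ ∈ s, (n μ : ℂ) * μ ^ t := by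
  obtain ⟨d, ρ, hρ, rfl⟩ := hχ
  obtain ⟨s, n, h, h'⟩ := exists_trace_pow_eq_sum Monoid.exponent_ne_zero_of_finite (ρ x) (by
    rw [← map_pow, Monoid.pow_exponent_eq_one, map_one])
  exact ⟨s, n, h, fun t => by rw [← h' t, ← map_pow]; rfl⟩

section CyclotomicValues

variable {G : Type*} [Group G] [Finite G] {ω : ℂ} (hω : IsPrimitiveRoot ω (Monoid.exponent G))

/-- Galois automorphisms act on the values of characters through powers of the group elements. -/
theorem exists_irrChar_eq_and_galois {χ : G → ℂ} (hχ : χ ∈ irrChar G) (x : G) :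
    ∃ y : IntermediateField.adjoin ℚ {ω}, (y : ℂ) = χ x ∧
      ∀ σ : IntermediateField.adjoin ℚ {ω} ≃ₐ[ℚ] IntermediateField.adjoin ℚ {ω},
        (σ y : ℂ) = χ (x ^ ((cycloEta hω σ : (ZMod (Monoid.exponent G))ˣ) :
          ZMod (Monoid.exponent G)).val) := by
  obtain ⟨s, n, hs, hn⟩ := exists_irrChar_pow_eq_sum hχ x
  have hpow : ∀ μ : s, ∃ i : ℕ, ω ^ i = μ := fun μ => by
    obtain ⟨i, -, hi⟩ := hω.eq_pow_of_pow_eq_one (hs μ μ.2)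
    exact ⟨i, hi⟩
  choose i hi using hpow
  let ζ : IntermediateField.adjoin ℚ {ω} := ⟨ω, IntermediateField.mem_adjoin_simple_self ℚ ω⟩
  refine ⟨∑ μ : s, (n μ : IntermediateField.adjoin ℚ {ω}) * ζ ^ i μ, ?_, fun σ => ?_⟩
  · have h1 := hn 1
    rw [pow_one, ← Finset.sum_coe_sort] at h1
    rw [h1]
    push_cast
    exact Finset.sum_congr rfl fun μ _ => by rw [pow_one, ← hi μ]
  · rw [hn, ← Finset.sum_coe_sort s, map_sum]
    push_cast
    refine Finset.sum_congr rfl fun μ _ => ?_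
    rw [map_mul, map_natCast, map_pow]
    push_cast
    rw [cycloEta_spec hω σ, ← hi μ, ← pow_mul, ← pow_mul, mul_comm (i μ)]

theorem exists_charSum_eq_and_galois {χ : G → ℂ} (hχ : χ ∈ irrChar G) (X : Multiset G) :
    ∃ y : IntermediateField.adjoin ℚ {ω}, (y : ℂ) = charSum χ X ∧
      ∀ σ : IntermediateField.adjoin ℚ {ω} ≃ₐ[ℚ] IntermediateField.adjoin ℚ {ω},
        (σ y : ℂ) = charSum χ (multisetPow X (cycloEta hω σ)) := by
  induction X using Multiset.induction with
  | empty => exact ⟨0, by simp [charSum], fun σ => by simp [charSum, multisetPow]⟩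
  | cons a X ih =>
    obtain ⟨y, hy, hyσ⟩ := ih
    obtain ⟨z, hz, hzσ⟩ := exists_irrChar_eq_and_galois hω hχ a
    refine ⟨z + y, ?_, fun σ => ?_⟩
    · simp only [charSum, Multiset.map_cons, Multiset.sum_cons] at hy ⊢
      push_cast
      rw [hz, hy]
    · have h := hyσ σ
      simp only [charSum, multisetPow, Multiset.map_cons, Multiset.sum_cons] at h ⊢
      rw [map_add]
      push_cast
      rw [hzσ, h]

/-- Injectivity suffices, since irreducibility of the cyclotomic polynomial over `ℚ` makes both
groups have order `φ(m)`. -/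
theorem cycloEta_bijective {m : ℕ} [NeZero m] {ω : ℂ} (hω : IsPrimitiveRoot ω m) :
    Function.Bijective (cycloEta hω) := by
  have hcyc : IsCyclotomicExtension {m} ℚ (IntermediateField.adjoin ℚ {ω}) :=
    (IntermediateField.isCyclotomicExtension_singleton_iff_eq_adjoin m ℚ ℂ _ hω).2 rfl
  have hfd : FiniteDimensional ℚ (IntermediateField.adjoin ℚ {ω}) :=
    IsCyclotomicExtension.finiteDimensional {m} ℚ _
  have hgal : IsGalois ℚ (IntermediateField.adjoin ℚ {ω}) :=
    IsCyclotomicExtension.isGalois {m} ℚ _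
  have hinj : Function.Injective (cycloEta hω) := IsPrimitiveRoot.autToPow_injective _ _
  rw [Nat.bijective_iff_injective_and_card]
  refine ⟨hinj, ?_⟩
  rw [IsGalois.card_aut_eq_finrank, Nat.card_eq_fintype_card, ZMod.card_units_eq_totient,
    IsCyclotomicExtension.finrank (n := m) _
      (Polynomial.cyclotomic.irreducible_rat (NeZero.pos m))]

/-- If `T` corresponds to the automorphisms that fix the elements of `S`, then the fixed field of `T`
is generated by `S`, and its degree is `φ(m) / |T|`. -/
theorem cycloFixed_eq_adjoin_and_finrank {m : ℕ} [NeZero m] {ω : ℂ} (hω : IsPrimitiveRoot ω m)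
    (T : Set (ZMod m)ˣ) (S : Set (IntermediateField.adjoin ℚ {ω}))
    (hS : ∀ σ, cycloEta hω σ ∈ T ↔ ∀ x ∈ S, σ x = x) :
    cycloFixed hω T = IntermediateField.adjoin ℚ (Subtype.val '' S) ∧
      Module.finrank ℚ (cycloFixed hω T) * Nat.card T = Nat.totient m := by
  have hcyc : IsCyclotomicExtension {m} ℚ (IntermediateField.adjoin ℚ {ω}) :=
    (IntermediateField.isCyclotomicExtension_singleton_iff_eq_adjoin m ℚ ℂ _ hω).2 rfl
  have hfd : FiniteDimensional ℚ (IntermediateField.adjoin ℚ {ω}) :=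
    IsCyclotomicExtension.finiteDimensional {m} ℚ _
  have hgal : IsGalois ℚ (IntermediateField.adjoin ℚ {ω}) :=
    IsCyclotomicExtension.isGalois {m} ℚ _
  -- `T` is only a set, but `hS` makes its preimage the fixing subgroup of `ℚ(S)`, so the Galois
  -- correspondence applies.
  have hfix : ∀ σ, cycloEta hω σ ∈ T ↔ σ ∈ (IntermediateField.adjoin ℚ S).fixingSubgroup := by
    intro σ
    rw [hS, IntermediateField.mem_fixingSubgroup_iff]
    refine ⟨fun h x hx => ?_, fun h x hx => h x (IntermediateField.subset_adjoin ℚ S hx)⟩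
    induction hx using IntermediateField.adjoin_induction with
    | mem x hx => exact h x hx
    | algebraMap x => exact σ.commutes x
    | add x y _ _ hx hy => rw [map_add, hx, hy]
    | inv x _ hx => rw [map_inv₀, hx]
    | mul x y _ _ hx hy => rw [map_mul, hx, hy]
  have heq : cycloFixedAux hω T = IntermediateField.adjoin ℚ S := by
    rw [← IsGalois.fixedField_fixingSubgroup (IntermediateField.adjoin ℚ S)]
    ext x
    rw [IntermediateField.mem_fixedField_iff]
    exact forall_congr' fun σ => imp_congr_left (hfix σ)
  refine ⟨by rw [cycloFixed, heq]; exact IntermediateField.lift_adjoin _ _ S, ?_⟩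
  have hcard : Nat.card T = Nat.card (IntermediateField.adjoin ℚ S).fixingSubgroup :=
    (Nat.card_congr ((Equiv.ofBijective _ (cycloEta_bijective hω)).subtypeEquiv
      fun σ => (hfix σ).symm)).symm
  have hlift : Module.finrank ℚ (cycloFixed hω T) = Module.finrank ℚ (cycloFixedAux hω T) :=
    (IntermediateField.liftAlgEquiv (cycloFixedAux hω T)).toLinearEquiv.finrank_eq.symm
  rw [hcard, hlift, heq, IsGalois.card_fixingSubgroup_eq_finrank, Module.finrank_mul_finrank,
    IsCyclotomicExtension.finrank (n := m) _
      (Polynomial.cyclotomic.irreducible_rat (NeZero.pos m))]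

end CyclotomicValues

/-! ### Conjugation-invariant multisets and their character sums -/

section ConjugationInvariance

variable {G : Type*} [Group G]

theorem IsConjClosed.map_conj {B : Finset G} (hB : IsConjClosed B) (k : G) :
    B.val.map (fun x => k * x * k⁻¹) = B.val := by
  classical
  have hsub : B.map (MulAut.conj k).toEquiv.toEmbedding ⊆ B := by
    intro x hx
    rw [Finset.mem_map] at hx
    obtain ⟨y, hy, rfl⟩ := hx
    simpa using hB y hy k⁻¹
  have h := Finset.eq_of_subset_of_card_le hsub (by rw [Finset.card_map])
  exact congrArg Finset.val h

theorem IsConjClosed.mem_conj_iff {B : Finset G} (hB : IsConjClosed B) (k g : G) :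
    k * g * k⁻¹ ∈ B ↔ g ∈ B := by
  constructor
  · intro h
    have := hB _ h k
    simpa [mul_assoc] using this
  · intro h
    simpa using hB g h k⁻¹

theorem multisetMul_map_conj {X Y : Multiset G} (k : G)
    (hX : X.map (fun x => k * x * k⁻¹) = X) (hY : Y.map (fun x => k * x * k⁻¹) = Y) :
    (multisetMul X Y).map (fun x => k * x * k⁻¹) = multisetMul X Y := by
  have hbind : ∀ X Y : Multiset G, multisetMul X Y = X.bind fun a => Y.map fun b => a * b := by
    intro X Y
    change Multiset.map _ (X.bind fun a => Y.map (Prod.mk a)) = _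
    rw [Multiset.map_bind]
    simp only [Multiset.map_map, Function.comp_def]
  conv_rhs => rw [hbind, ← hX, ← hY, Multiset.bind_map]
  rw [hbind, Multiset.map_bind]
  simp only [Multiset.map_map, Function.comp_def]
  refine Multiset.bind_congr fun a _ => Multiset.map_congr rfl fun b _ => ?_
  group

theorem multisetPow_map_conj {X : Multiset G} (k : G)
    (hX : X.map (fun x => k * x * k⁻¹) = X) (t : (ZMod (Monoid.exponent G))ˣ) :
    (multisetPow X t).map (fun x => k * x * k⁻¹) = multisetPow X t := by
  conv_rhs => rw [multisetPow, ← hX, Multiset.map_map]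
  rw [multisetPow, Multiset.map_map]
  exact Multiset.map_congr rfl fun x _ => (conj_pow).symm

omit [Group G] in
theorem charSum_eq_sum_count [Fintype G] [DecidableEq G] (χ : G → ℂ) (X : Multiset G) :
    charSum χ X = ∑ g, (X.count g : ℂ) * χ g := by
  rw [charSum, Finset.sum_multiset_map_count]
  simp only [nsmul_eq_mul]
  refine Finset.sum_subset (Finset.subset_univ _) fun g _ hg => ?_
  rw [Multiset.count_eq_zero_of_notMem (by simpa using hg), Nat.cast_zero, zero_mul]

/-- Conjugation-invariant multisets are determined by the irreducible characters. -/
theorem eq_of_forall_charSum_eq [Finite G] {X Y : Multiset G}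
    (hX : ∀ k : G, X.map (fun x => k * x * k⁻¹) = X)
    (hY : ∀ k : G, Y.map (fun x => k * x * k⁻¹) = Y)
    (h : ∀ χ ∈ irrChar G, charSum χ X = charSum χ Y) : X = Y := by
  classical
  have := Fintype.ofFinite G
  have hcount : ∀ {Z : Multiset G}, (∀ k : G, Z.map (fun x => k * x * k⁻¹) = Z) →
      ∀ k g, Z.count (k * g * k⁻¹) = Z.count g := by
    intro Z hZ k g
    conv_lhs => rw [← hZ k]
    exact Multiset.count_map_eq_count' (fun x => k * x * k⁻¹) Z (MulAut.conj k).injective g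
  have hzero := eq_zero_of_forall_irrChar_sum_eq_zero
    (fun g => (X.count g : ℂ) - (Y.count g : ℂ))
    (fun k g => by rw [hcount hX, hcount hY]) (fun χ hχ => by
      simp only [sub_mul, Finset.sum_sub_distrib, ← charSum_eq_sum_count, h χ hχ, sub_self])
  ext g
  have := congrFun hzero g
  exact_mod_cast sub_eq_zero.1 this

omit [Group G] in
theorem charSum_val_eq_sum_indicator [Fintype G] [DecidableEq G] (χ : G → ℂ) (B : Finset G) :
    charSum χ B.val = ∑ g, (if g ∈ B then 1 else 0) * χ g := by
  simp [charSum]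

/-- The indicator of `B` is a class function, so it acts through the central character, with scalar
`χ(B) / χ(1)`. For `A = B` this lets the multiset `BB` stand for the number `χ(B)²`. -/
theorem charSum_multisetMul_mul [Finite G] {χ : G → ℂ} (hχ : χ ∈ irrChar G) (A B : Finset G)
    (hB : IsConjClosed B) :
    charSum χ (multisetMul A.val B.val) * χ 1 = charSum χ A.val * charSum χ B.val := by
  classical
  have := Fintype.ofFinite G
  have h := irrChar_sum_mul hχ (fun g => if g ∈ B then 1 else 0)
    (fun k g => by simp only [hB.mem_conj_iff])
  rw [← charSum_val_eq_sum_indicator] at h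
  have h1 : charSum χ (multisetMul A.val B.val) = ∑ a ∈ A, ∑ b ∈ B, χ (a * b) := by
    rw [← Finset.sum_product', charSum, multisetMul, Multiset.map_map]
    rfl
  have h2 : charSum χ A.val = ∑ a ∈ A, χ a := rfl
  rw [h1, h2, Finset.sum_mul, Finset.sum_mul]
  refine Finset.sum_congr rfl fun a _ => ?_
  rw [mul_comm (χ a), ← h a]
  simp

end ConjugationInvariance

/-! ### The field `K` as a field of character values -/

section FixedField

variable {G : Type*} [Group G] [Finite G] {ω : ℂ} (hω : IsPrimitiveRoot ω (Monoid.exponent G))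

/-- The values on which the automorphisms in `stabUnits` act trivially. -/
def stabValues (A B : Finset G) : Set ℂ :=
  {z | ∃ χ ∈ irrChar G, z = charSum χ A.val ∨ z = charSum χ B.val ^ 2}

theorem galois_charSum_eq_iff {χ : G → ℂ} (hχ : χ ∈ irrChar G) (X : Multiset G)
    (σ : IntermediateField.adjoin ℚ {ω} ≃ₐ[ℚ] IntermediateField.adjoin ℚ {ω})
    {y : IntermediateField.adjoin ℚ {ω}} (hy : (y : ℂ) = charSum χ X) :
    σ y = y ↔ charSum χ (multisetPow X (cycloEta hω σ)) = charSum χ X := by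
  obtain ⟨z, hz, hzσ⟩ := exists_charSum_eq_and_galois hω hχ X
  obtain rfl : y = z := Subtype.ext (hy.trans hz.symm)
  rw [← hzσ, ← hy, Subtype.coe_inj]

/-- Both `A` and `BB` are conjugation-invariant, so equality with their `t`-th powers can be tested
on irreducible characters, where taking powers is the Galois action. -/
theorem mem_stabUnits_iff_forall_fixed {A B : Finset G} (hA : IsConjClosed A) (hB : IsConjClosed B)
    (σ : IntermediateField.adjoin ℚ {ω} ≃ₐ[ℚ] IntermediateField.adjoin ℚ {ω}) :
    cycloEta hω σ ∈ stabUnits A B ↔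
      ∀ x : IntermediateField.adjoin ℚ {ω}, (x : ℂ) ∈ stabValues A B → σ x = x := by
  have hpow : ∀ {X : Multiset G}, (∀ k : G, X.map (fun x => k * x * k⁻¹) = X) →
      (multisetPow X (cycloEta hω σ) = X ↔ ∀ χ ∈ irrChar G,
        charSum χ (multisetPow X (cycloEta hω σ)) = charSum χ X) := fun hX =>
    ⟨fun h χ _ => by rw [h], fun h =>
      eq_of_forall_charSum_eq (fun k => multisetPow_map_conj k (hX k) _) hX h⟩
  have hBB := fun k => multisetMul_map_conj k (hB.map_conj k) (hB.map_conj k)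
  -- `χ(B)²` and `χ(BB)` differ by the factor `χ(1)`, a nonzero natural number, which `σ` fixes.
  have hsq : ∀ χ ∈ irrChar G, ∀ (x y : IntermediateField.adjoin ℚ {ω}),
      (x : ℂ) = charSum χ B.val ^ 2 → (y : ℂ) = charSum χ (multisetMul B.val B.val) →
      (σ x = x ↔ σ y = y) := by
    intro χ hχ x y hx hy
    obtain ⟨d, hd⟩ := irrChar_one_eq_natCast hχ
    have hxy : x = y * d := by
      apply Subtype.ext
      push_cast
      rw [hx, hy, ← hd, charSum_multisetMul_mul hχ B B hB, sq]
    have hd0 : (d : IntermediateField.adjoin ℚ {ω}) ≠ 0 := by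
      have := irrChar_one_ne_zero hχ
      rw [hd] at this
      exact_mod_cast this
    rw [hxy, map_mul, map_natCast, mul_left_inj' hd0]
  change _ ∧ _ ↔ _
  rw [hpow hA.map_conj, hpow hBB]
  constructor
  · rintro ⟨h1, h2⟩ x ⟨χ, hχ, hx | hx⟩
    · exact (galois_charSum_eq_iff hω hχ _ σ hx).2 (h1 χ hχ)
    · obtain ⟨y, hy, -⟩ := exists_charSum_eq_and_galois hω hχ (multisetMul B.val B.val)
      exact (hsq χ hχ x y hx hy).2 ((galois_charSum_eq_iff hω hχ _ σ hy).2 (h2 χ hχ))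
  · intro h
    refine ⟨fun χ hχ => ?_, fun χ hχ => ?_⟩
    · obtain ⟨y, hy, -⟩ := exists_charSum_eq_and_galois hω hχ A.val
      exact (galois_charSum_eq_iff hω hχ _ σ hy).1 (h y ⟨χ, hχ, Or.inl hy⟩)
    · obtain ⟨y, hy, -⟩ := exists_charSum_eq_and_galois hω hχ (multisetMul B.val B.val)
      obtain ⟨x, hx, -⟩ := exists_charSum_eq_and_galois hω hχ B.val
      have hx2 : ((x ^ 2 : IntermediateField.adjoin ℚ {ω}) : ℂ) = charSum χ B.val ^ 2 := by
        push_cast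
        rw [hx]
      exact (galois_charSum_eq_iff hω hχ _ σ hy).1
        ((hsq χ hχ _ y hx2 hy).1 (h _ ⟨χ, hχ, Or.inr hx2⟩))

theorem cycloFixed_stabUnits {A B : Finset G} (hA : IsConjClosed A) (hB : IsConjClosed B) :
    cycloFixed hω (stabUnits A B) = IntermediateField.adjoin ℚ (stabValues A B) ∧
      Module.finrank ℚ (cycloFixed hω (stabUnits A B)) * Nat.card (stabUnits A B) =
        Nat.totient (Monoid.exponent G) := by
  have h := cycloFixed_eq_adjoin_and_finrank hω (stabUnits A B)
    {x | (x : ℂ) ∈ stabValues A B} (mem_stabUnits_iff_forall_fixed hω hA hB)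
  refine ⟨h.1.trans (congrArg _ ?_), h.2⟩
  ext z
  refine ⟨?_, fun hz => ?_⟩
  · rintro ⟨x, hx, rfl⟩
    exact hx
  · obtain ⟨χ, hχ, rfl | rfl⟩ := id hz
    · obtain ⟨y, hy, -⟩ := exists_charSum_eq_and_galois hω hχ A.val
      exact ⟨y, by rw [Set.mem_ofPred_eq, hy]; exact hz, hy⟩
    · obtain ⟨y, hy, -⟩ := exists_charSum_eq_and_galois hω hχ B.val
      have hy2 : ((y ^ 2 : IntermediateField.adjoin ℚ {ω}) : ℂ) = charSum χ B.val ^ 2 := by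
        push_cast
        rw [hy]
      exact ⟨y ^ 2, by rw [Set.mem_ofPred_eq, hy2]; exact hz, hy2⟩

end FixedField

/-! ### Spectrum and splitting field of the semi-Cayley digraph -/

theorem semiCayley_mulVec {G : Type*} [Group G] [Fintype G] [DecidableEq G] (A B : Finset G)
    (v : G ⊕ G → ℂ) (h : G) :
    ((digraphAdjMatrix (semiCayley A A B B)).map (algebraMap ℚ ℂ)).mulVec v (Sum.inl h) =
        ∑ g, (if g ∈ A then 1 else 0) * v (Sum.inl (g * h)) +
          ∑ g, (if g ∈ B then 1 else 0) * v (Sum.inr (g * h)) ∧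
      ((digraphAdjMatrix (semiCayley A A B B)).map (algebraMap ℚ ℂ)).mulVec v (Sum.inr h) =
        ∑ g, (if g ∈ B then 1 else 0) * v (Sum.inl (g * h)) +
          ∑ g, (if g ∈ A then 1 else 0) * v (Sum.inr (g * h)) := by
  have hsum : ∀ (C : Finset G) (f : G → ℂ),
      ∑ g, (if g * h⁻¹ ∈ C then 1 else 0) * f g = ∑ g, (if g ∈ C then 1 else 0) * f (g * h) :=
    fun C f => Fintype.sum_equiv (Equiv.mulRight h⁻¹) _ _ fun g => by
      rw [Equiv.coe_mulRight, inv_mul_cancel_right]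
  have hentry : ∀ (x y : G ⊕ G) (p : Prop) [Decidable p], (semiCayleyAdj A A B B x y ↔ p) →
      ((digraphAdjMatrix (semiCayley A A B B)).map (algebraMap ℚ ℂ)) x y = if p then 1 else 0 := by
    intro x y p _ h
    by_cases hp : p
    · simp [digraphAdjMatrix, semiCayley, h.2 hp, hp]
    · simp [digraphAdjMatrix, semiCayley, mt h.1 hp, hp]
  simp only [Matrix.mulVec, dotProduct, Fintype.sum_sum_type]
  constructor
  · rw [← hsum A fun g => v (Sum.inl g), ← hsum B fun g => v (Sum.inr g)]
    congr 1 <;> exact Finset.sum_congr rfl fun g _ => congrArg (· * _) (hentry _ _ (_ ∈ _) Iff.rfl)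
  · rw [← hsum B fun g => v (Sum.inl g), ← hsum A fun g => v (Sum.inr g)]
    congr 1 <;> exact Finset.sum_congr rfl fun g _ => congrArg (· * _) (hentry _ _ (_ ∈ _) Iff.rfl)

/-- The eigenvalues of a quasi-abelian semi-Cayley digraph. -/
theorem mem_rootSet_charpoly_semiCayley_iff {G : Type*} [Group G] [Fintype G] [DecidableEq G]
    {A B : Finset G} (hA : IsConjClosed A) (hB : IsConjClosed B) (μ : ℂ) :
    μ ∈ (digraphAdjMatrix (semiCayley A A B B)).charpoly.rootSet ℂ ↔
      ∃ χ ∈ irrChar G, μ = (charSum χ A.val + charSum χ B.val) / χ 1 ∨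
        μ = (charSum χ A.val - charSum χ B.val) / χ 1 := by
  have hw : ∀ (ε : ℂ) (k g : G), (if k * g * k⁻¹ ∈ A then 1 else 0) +
      ε * (if k * g * k⁻¹ ∈ B then 1 else 0) = (if g ∈ A then 1 else 0) +
        ε * (if g ∈ B then 1 else 0) := fun ε k g => by
    simp only [hA.mem_conj_iff, hB.mem_conj_iff]
  have hsum : ∀ (ε : ℂ) (f : G → ℂ), ∑ g, ((if g ∈ A then 1 else 0) +
      ε * (if g ∈ B then 1 else 0)) * f g = ∑ g, (if g ∈ A then 1 else 0) * f g +
        ε * ∑ g, (if g ∈ B then 1 else 0) * f g := fun ε f => by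
    simp only [add_mul, Finset.sum_add_distrib, mul_assoc, Finset.mul_sum]
  rw [Polynomial.mem_rootSet_of_ne (Matrix.charpoly_monic _).ne_zero, Polynomial.aeval_def,
    Polynomial.eval₂_eq_eval_map, ← Matrix.charpoly_map, ← Polynomial.IsRoot.def,
    isRoot_charpoly_iff_exists_mulVec]
  constructor
  · rintro ⟨v, hv, hvμ⟩
    -- For `ε = ±1` the combination `v₁ + ε v₂` of the two halves of `v` satisfies the eigenvalue
    -- equation of the convolution by `1_A + ε 1_B`.
    have heig : ∀ ε : ℂ, ε ^ 2 = 1 → ∀ h, ∑ g, ((if g ∈ A then 1 else 0) +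
        ε * (if g ∈ B then 1 else 0)) * (v (Sum.inl (g * h)) + ε * v (Sum.inr (g * h))) =
          μ * (v (Sum.inl h) + ε * v (Sum.inr h)) := by
      intro ε hε h
      have h1 := congrFun hvμ (Sum.inl h)
      have h2 := congrFun hvμ (Sum.inr h)
      rw [(semiCayley_mulVec A B v h).1, Pi.smul_apply, smul_eq_mul] at h1
      rw [(semiCayley_mulVec A B v h).2, Pi.smul_apply, smul_eq_mul] at h2
      rw [hsum]
      simp only [mul_add, Finset.sum_add_distrib, mul_left_comm _ ε, ← Finset.mul_sum]
      linear_combination h1 + ε * h2 + (∑ g, (if g ∈ B then 1 else 0) * v (Sum.inr (g * h))) * hε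
    have hmem : ∀ ε : ℂ, ε ^ 2 = 1 → (fun h => v (Sum.inl h) + ε * v (Sum.inr h)) ≠ 0 →
        ∃ χ ∈ irrChar G, μ = (charSum χ A.val + ε * charSum χ B.val) / χ 1 := by
      intro ε hε hne
      obtain ⟨χ, hχ, h⟩ := exists_irrChar_of_eigenfunction
        (fun g => (if g ∈ A then 1 else 0) + ε * (if g ∈ B then 1 else 0)) (hw ε) hne (heig ε hε)
      refine ⟨χ, hχ, ?_⟩
      rw [eq_div_iff (irrChar_one_ne_zero hχ), ← h, hsum, charSum_val_eq_sum_indicator,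
        charSum_val_eq_sum_indicator]
    -- The sum and the difference of the halves cannot both vanish, since `v ≠ 0`.
    by_cases hp : (fun h => v (Sum.inl h) + 1 * v (Sum.inr h)) = 0
    · have hm : (fun h => v (Sum.inl h) + (-1) * v (Sum.inr h)) ≠ 0 := by
        intro hm
        apply hv
        ext (h | h)
        · have h1 := congrFun hp h
          have h2 := congrFun hm h
          simp only [Pi.zero_apply] at h1 h2 ⊢
          linear_combination (h1 + h2) / 2
        · have h1 := congrFun hp h
          have h2 := congrFun hm h
          simp only [Pi.zero_apply] at h1 h2 ⊢
          linear_combination (h1 - h2) / 2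
      obtain ⟨χ, hχ, h⟩ := hmem (-1) (by norm_num) hm
      exact ⟨χ, hχ, Or.inr (by rw [h]; ring)⟩
    · obtain ⟨χ, hχ, h⟩ := hmem 1 (by norm_num) hp
      exact ⟨χ, hχ, Or.inl (by rw [h]; ring)⟩
  · have hex : ∀ χ ∈ irrChar G, ∀ ε : ℂ, ε ^ 2 = 1 →
        μ = (charSum χ A.val + ε * charSum χ B.val) / χ 1 → ∃ v : G ⊕ G → ℂ, v ≠ 0 ∧
          ((digraphAdjMatrix (semiCayley A A B B)).map (algebraMap ℚ ℂ)).mulVec v = μ • v := by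
      intro χ hχ ε hε hμ
      obtain ⟨φ, hφ, h⟩ := exists_eigenfunction_of_irrChar hχ
        (fun g => (if g ∈ A then 1 else 0) + ε * (if g ∈ B then 1 else 0)) (hw ε)
      rw [hsum, ← charSum_val_eq_sum_indicator, ← charSum_val_eq_sum_indicator, ← hμ] at h
      refine ⟨Sum.elim φ (ε • φ), fun h0 => hφ ?_, ?_⟩
      · ext g
        exact congrFun h0 (Sum.inl g)
      · ext (k | k)
        · rw [(semiCayley_mulVec A B _ k).1]
          have h1 := h k
          rw [hsum] at h1
          simp only [Sum.elim_inl, Sum.elim_inr, Pi.smul_apply, smul_eq_mul, mul_left_comm _ ε,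
            ← Finset.mul_sum]
          exact h1
        · rw [(semiCayley_mulVec A B _ k).2]
          have h1 := h k
          rw [hsum] at h1
          simp only [Sum.elim_inl, Sum.elim_inr, Pi.smul_apply, smul_eq_mul, mul_left_comm _ ε,
            ← Finset.mul_sum]
          linear_combination ε * h1 - (∑ g, (if g ∈ B then 1 else 0) * φ (g * k)) * hε
    rintro ⟨χ, hχ, h | h⟩
    · exact hex χ hχ 1 (by norm_num) (by rw [h]; ring)
    · exact hex χ hχ (-1) (by norm_num) (by rw [h]; ring)

theorem digraphSplittingField_semiCayley {G : Type*} [Group G] [Fintype G] [DecidableEq G]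
    {A B : Finset G} (hA : IsConjClosed A) (hB : IsConjClosed B) :
    digraphSplittingField (semiCayley A A B B) = IntermediateField.adjoin ℚ
      {z : ℂ | ∃ χ ∈ irrChar G, z = charSum χ A.val ∨ z = charSum χ B.val} := by
  apply le_antisymm
  · rw [digraphSplittingField, IntermediateField.adjoin_le_iff]
    intro μ hμ
    obtain ⟨χ, hχ, h⟩ := (mem_rootSet_charpoly_semiCayley_iff hA hB μ).1 hμ
    obtain ⟨d, hd⟩ := irrChar_one_eq_natCast hχ
    have h1 := IntermediateField.subset_adjoin ℚ
      {z : ℂ | ∃ χ ∈ irrChar G, z = charSum χ A.val ∨ z = charSum χ B.val}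
      ⟨χ, hχ, Or.inl rfl⟩
    have h2 := IntermediateField.subset_adjoin ℚ
      {z : ℂ | ∃ χ ∈ irrChar G, z = charSum χ A.val ∨ z = charSum χ B.val}
      ⟨χ, hχ, Or.inr rfl⟩
    rw [hd] at h
    rcases h with rfl | rfl
    · exact div_mem (add_mem h1 h2) (natCast_mem _ d)
    · exact div_mem (sub_mem h1 h2) (natCast_mem _ d)
  · rw [IntermediateField.adjoin_le_iff]
    rintro z ⟨χ, hχ, hz⟩
    obtain ⟨d, hd⟩ := irrChar_one_eq_natCast hχ
    have hd0 := irrChar_one_ne_zero hχ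
    have h1 := IntermediateField.subset_adjoin ℚ _
      ((mem_rootSet_charpoly_semiCayley_iff hA hB _).2 ⟨χ, hχ, Or.inl rfl⟩)
    have h2 := IntermediateField.subset_adjoin ℚ _
      ((mem_rootSet_charpoly_semiCayley_iff hA hB _).2 ⟨χ, hχ, Or.inr rfl⟩)
    rw [SetLike.mem_coe, digraphSplittingField]
    rw [hd] at h1 h2 hd0
    rcases hz with rfl | rfl
    -- Half the sum of the two eigenvalues for `χ`, times `d = χ(1)`, is `χ(A)`; half the difference
    -- gives `χ(B)` below.
    · convert div_mem (mul_mem (add_mem h1 h2) (natCast_mem _ d)) (ofNat_mem _ 2) using 1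
      field_simp
      ring
    · convert div_mem (mul_mem (sub_mem h1 h2) (natCast_mem _ d)) (ofNat_mem _ 2) using 1
      field_simp
      ring

/-! ### The main theorem -/

theorem mainTheorem6 {G : Type*} [Group G] [Fintype G] [DecidableEq G]
    (T₁₁ T₂₂ T₁₂ T₂₁ : Finset G)
    (hc₁₁ : IsConjClosed T₁₁) (hc₂₂ : IsConjClosed T₂₂)
    (hc₁₂ : IsConjClosed T₁₂) (hc₂₁ : IsConjClosed T₂₁)
    (h₁ : T₁₁ = T₂₂) (h₂ : T₁₂ = T₁₂⁻¹) (h₃ : T₁₂⁻¹ = T₂₁)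
    (ω : ℂ) (hω : IsPrimitiveRoot ω (Monoid.exponent G))
    (T : Set (ZMod (Monoid.exponent G))ˣ) (hT : T = stabUnits T₁₁ T₁₂)
    (K : IntermediateField ℚ ℂ) (hK : K = cycloFixed hω T) :
    -- the splitting field
    digraphSplittingField (semiCayley T₁₁ T₂₂ T₁₂ T₂₁) =
        IntermediateField.adjoin ℚ
          {z : ℂ | ∃ χ ∈ irrChar G, z = charSum χ T₁₁.val ∨ z = charSum χ T₁₂.val} ∧
      digraphSplittingField (semiCayley T₁₁ T₂₂ T₁₂ T₂₁) =
        (IntermediateField.adjoin K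
          {z : ℂ | ∃ χ ∈ irrChar G, z = charSum χ T₁₂.val}).restrictScalars ℚ ∧
    -- the squares that define the group `M` lie in `K`
      (∀ χ ∈ irrChar G, charSum χ T₁₂.val ^ 2 ∈ K) ∧
    -- the algebraic degree
      (algebraicDegree (semiCayley T₁₁ T₂₂ T₁₂ T₂₁) : ℚ) =
        (Nat.totient (Monoid.exponent G) : ℚ) *
          Nat.card (squareClassGroup K
            {z : ℂ | ∃ χ ∈ irrChar G, z = charSum χ T₁₂.val ^ 2}) /
          Nat.card T := by
  have h₄ : T₂₁ = T₁₂ := h₃ ▸ h₂.symm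
  -- From here on `T₂₁` also stands for `T₁₂`, and `T₁₁` for `T₂₂`.
  subst h₄ h₁ hT
  obtain ⟨hKadj, hKrank⟩ := cycloFixed_stabUnits hω hc₁₁ hc₁₂
  rw [← hK] at hKadj hKrank
  have hSF := digraphSplittingField_semiCayley hc₁₁ hc₁₂
  have hsq : ∀ χ ∈ irrChar G, charSum χ T₂₁.val ^ 2 ∈ K := fun χ hχ =>
    hKadj ▸ IntermediateField.subset_adjoin ℚ _ ⟨χ, hχ, Or.inr rfl⟩
  have hSFK : digraphSplittingField (semiCayley T₁₁ T₁₁ T₂₁ T₂₁) =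
      (IntermediateField.adjoin K
        {z : ℂ | ∃ χ ∈ irrChar G, z = charSum χ T₂₁.val}).restrictScalars ℚ := by
    rw [hSF]
    refine Eq.trans ?_ (IntermediateField.restrictScalars_adjoin ℚ K _).symm
    apply le_antisymm
    · rw [IntermediateField.adjoin_le_iff]
      rintro z ⟨χ, hχ, rfl | rfl⟩
      · refine IntermediateField.subset_adjoin ℚ _ (Or.inl ?_)
        rw [hKadj]
        exact IntermediateField.subset_adjoin ℚ _ ⟨χ, hχ, Or.inl rfl⟩
      · exact IntermediateField.subset_adjoin ℚ _ (Or.inr ⟨χ, hχ, rfl⟩)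
    · rw [IntermediateField.adjoin_le_iff, Set.union_subset_iff]
      constructor
      · rw [SetLike.coe_subset_coe, hKadj, IntermediateField.adjoin_le_iff]
        rintro z ⟨χ, hχ, rfl | rfl⟩
        · exact IntermediateField.subset_adjoin ℚ _ ⟨χ, hχ, Or.inl rfl⟩
        · refine pow_mem (IntermediateField.subset_adjoin ℚ _ ?_) 2
          exact ⟨χ, hχ, Or.inr rfl⟩
      · rintro z ⟨χ, hχ, rfl⟩
        exact IntermediateField.subset_adjoin ℚ _ ⟨χ, hχ, Or.inr rfl⟩
  refine ⟨hSF, hSFK, hsq, ?_⟩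
  have hkummer := finrank_adjoin_of_sq_mem (K := K)
    (S := {z : ℂ | ∃ χ ∈ irrChar G, z = charSum χ T₂₁.val}) (by
      rintro z ⟨χ, hχ, rfl⟩
      exact ⟨⟨_, hsq χ hχ⟩, rfl⟩)
  have hM : squareClassGroup K {z : ℂ | ∃ χ ∈ irrChar G, z = charSum χ T₂₁.val ^ 2} =
      Subgroup.closure {c : (K : Type)ˣ ⧸ (powMonoidHom 2 : (K : Type)ˣ →* (K : Type)ˣ).range |
        ∃ a : (K : Type)ˣ, (∃ s ∈ {z : ℂ | ∃ χ ∈ irrChar G, z = charSum χ T₂₁.val},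
          algebraMap K ℂ a = s ^ 2) ∧ c = QuotientGroup.mk a} := by
    rw [squareClassGroup]
    congr 1
    ext c
    refine exists_congr fun a => and_congr_left fun _ => ⟨?_, ?_⟩
    · rintro ⟨χ, hχ, h⟩
      exact ⟨_, ⟨χ, hχ, rfl⟩, h⟩
    · rintro ⟨_, ⟨χ, hχ, rfl⟩, h⟩
      exact ⟨χ, hχ, h⟩
  -- The tower law for `ℚ ⊆ K ⊆ K(χ(B))`, with Kummer theory for the upper step.
  have hdeg : algebraicDegree (semiCayley T₁₁ T₁₁ T₂₁ T₂₁) = Module.finrank ℚ K *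
      Nat.card (squareClassGroup K {z : ℂ | ∃ χ ∈ irrChar G, z = charSum χ T₂₁.val ^ 2}) := by
    rw [hM, ← hkummer, Module.finrank_mul_finrank, algebraicDegree, hSFK]
    rfl
  have hT0 : (Nat.card (stabUnits T₁₁ T₂₁) : ℚ) ≠ 0 := by
    intro h0
    rw [Nat.cast_eq_zero] at h0
    rw [h0, mul_zero] at hKrank
    exact (Nat.totient_pos.2 (NeZero.pos (Monoid.exponent G))).ne hKrank
  rw [eq_div_iff hT0, ← hKrank, hdeg]
  push_cast
  ring
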